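/- For a finite group $G$ and $u\in G$ define $\theta_u\colon G\to G$ by $\theta_u(g)=[g^{-u},g]$, where $[x,y]=x^{-1}y^{-1}xy$, $x^y=y^{-1}xy$ and $g^{-u}=(g^{-1})^u$. Let $\Theta_G(u)=\{g\in G\mid \theta_u^n(g)=g\text{ for some }n>0\}$; the map $\theta_u$ permutes $\Theta_G(u)$, and $\beta_G(u)$ denotes the number of its orbits on $\Theta_G(u)$ other than $\{1\}$. Let $m\geqslant 1$ be an integer, $q=2^{2m+1}$ and $s=2^{m+1}$. For $a,b\in\mathbb{F}_q$ and $k\in\mathbb{F}_q^\times$ put $$T(a,b)=\begin{pmatrix}1&0&0&0\\ a&1&0&0\\ a^{1+s}+b&a^s&1&0\\ a^{2+s}+ab+b^s&b&a&1\end{pmatrix},\qquad z=\begin{pmatrix}0&0&0&1\\0&0&1&0\\0&1&0&0\\1&0&0&0\end{pmatrix},$$ $D(k)=\mathrm{diag}(k^{s/2+1},k^{s/2},k^{-s/2},k^{-s/2-1})$, and let $G=Sz(q)$ be the Suzuki group, that is, the subgroup of $\mathrm{SL}_4(\mathbb{F}_q)$ generated by all $T(a,b)$, all $D(k)$ and $z$.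 If $\kappa$ is a real number with $\beta_G(u)\leqslant\kappa$ for every involution $u\in G$, then $|\mathrm{Aut}(G)|\leqslant\kappa^{12}$. Moreover, $u=T(0,1)$ is an involution of $G$ with $\beta_G(u)\geqslant\frac12(q-2)$. -/

import Mathlib

/-- The map `θ_u : G → G`, `θ_u(g) = [g^{-u}, g]`, where `[x, y] = x⁻¹ y⁻¹ x y`, `x ^ y = y⁻¹ x y`
and `g^{-u} = (g⁻¹)^u`. -/
def thetaMap {G : Type*} [Group G] (u g : G) : G :=
  (u⁻¹ * g⁻¹ * u)⁻¹ * g⁻¹ * (u⁻¹ * g⁻¹ * u) * g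

/-- The set `Θ_G(u)` of all `g` with `θ_u^n(g) = g` for some `n > 0`. -/
def thetaSet {G : Type*} [Group G] (u : G) : Set G :=
  {g | ∃ n : ℕ, 0 < n ∧ (thetaMap u)^[n] g = g}

/-- The orbit `{θ_u^n(g) | n ≥ 0}`; for `g ∈ Θ_G(u)` this is the cycle of the permutation
induced by `θ_u` on `Θ_G(u)` that contains `g`. -/
def thetaOrbit {G : Type*} [Group G] (u g : G) : Set G :=
  Set.range fun n : ℕ => (thetaMap u)^[n] g

/-- The eventual orbits of `θ_u`: its orbits on `Θ_G(u)` apart from the orbit `{1}`. -/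
def eventualOrbits {G : Type*} [Group G] (u : G) : Set (Set G) :=
  (thetaOrbit u '' thetaSet u) \ {{1}}

/-- `β_G(u)`, the number of eventual orbits of `θ_u` (for a finite group `G`). -/
noncomputable def beta {G : Type*} [Group G] (u : G) : ℕ :=
  (eventualOrbits u).ncard

/-- The matrix `T(a, b)`, with `s = 2 ^ (m + 1)`, so that `x ↦ x ^ s` is the automorphism of the
field with `2 ^ (2 * m + 1)` elements whose square is the Frobenius automorphism `x ↦ x ^ 2`. -/
def suzukiT {F : Type*} [Field F] (m : ℕ) (a b : F) : Matrix.SpecialLinearGroup (Fin 4) F :=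
  ⟨!![1, 0, 0, 0;
      a, 1, 0, 0;
      a ^ (1 + 2 ^ (m + 1)) + b, a ^ 2 ^ (m + 1), 1, 0;
      a ^ (2 + 2 ^ (m + 1)) + a * b + b ^ 2 ^ (m + 1), b, a, 1], by
    simp [Matrix.det_succ_row_zero, Fin.sum_univ_succ]⟩

/-- The matrix `D(k) = diag(k^{s/2+1}, k^{s/2}, k^{-s/2}, k^{-s/2-1})`, with `s / 2 = 2 ^ m`. -/
def suzukiD {F : Type*} [Field F] (m : ℕ) (k : Fˣ) : Matrix.SpecialLinearGroup (Fin 4) F :=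
  ⟨Matrix.diagonal ![(k : F) ^ (2 ^ m + 1), (k : F) ^ 2 ^ m,
      ((k : F) ^ 2 ^ m)⁻¹, ((k : F) ^ (2 ^ m + 1))⁻¹], by
    have hk : (k : F) ≠ 0 := k.ne_zero
    rw [Matrix.det_diagonal, Fin.prod_univ_four]
    simp only [Matrix.cons_val]
    field_simp⟩

/-- The antidiagonal permutation matrix `z`. -/
def suzukiZ (F : Type*) [Field F] : Matrix.SpecialLinearGroup (Fin 4) F :=
  ⟨!![0, 0, 0, 1;
      0, 0, 1, 0;
      0, 1, 0, 0;
      1, 0, 0, 0], by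
    simp [Matrix.det_succ_row_zero, Fin.sum_univ_succ, Fin.succAbove]
    ring⟩

/-- The Suzuki group `Sz(q)`, `q = 2 ^ (2 * m + 1)`, over a field `F` with `q` elements: the
subgroup of `SL_4(F)` generated by all `T(a, b)`, all `D(k)` with `k ≠ 0`, and `z`. -/
def suzukiGroup (m : ℕ) (F : Type*) [Field F] :
    Subgroup (Matrix.SpecialLinearGroup (Fin 4) F) :=
  Subgroup.closure
    ({g | ∃ a b : F, g = suzukiT m a b} ∪ {g | ∃ k : Fˣ, g = suzukiD m k} ∪ {suzukiZ F})

theorem suzukiT_mem {F : Type*} [Field F] (m : ℕ) (a b : F) :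
    suzukiT m a b ∈ suzukiGroup m F :=
  Subgroup.subset_closure (Or.inl (Or.inl ⟨a, b, rfl⟩))

/-- The element `u = T(0, 1)` of `Sz(q)`. -/
def suzukiU (m : ℕ) (F : Type*) [Field F] : suzukiGroup m F :=
  ⟨suzukiT m 0 1, suzukiT_mem m 0 1⟩

/-! Write q for the order of the field and P for the group of all T(a, b), of order q² and exponent
4, which centralizes u = T(0, 1). Conjugation by P commutes with `thetaMap u`. If p is periodic and
no nontrivial element of P commutes with p, the q² conjugates of p under P are distinct and
periodic. Those on one cycle correspond to a coset of a cyclic subgroup of P, so there are at most 4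
of them, and β(u) ≥ q²/4 (`card_le_mul_beta`). Such a p exists because the P-conjugates of elements
z D(k) T(0, b), with b ≠ 0, 1, form a set stable under `thetaMap u`, which replaces b by b + 1
(`exists_thetaMap_eq_conj`). Finiteness gives a periodic point there. On the other side, the Bruhat
decomposition gives |G| ≤ q⁵, and G has three generators, so |Aut G| ≤ q¹⁵. Since q ≥ 8, this is at
most (q²/4)¹². -/

/-! ### Counting cycles of θ_u by a group centralizing u. -/

section Orbits

variable {G : Type*} [Group G] {u : G}

theorem thetaMap_conj {c : G} (hc : Commute c u) (g : G) :
    thetaMap u (c⁻¹ * g * c) = c⁻¹ * thetaMap u g * c := by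
  have h : c⁻¹ * u * c = u := by rw [mul_assoc, ← hc.eq, inv_mul_cancel_left]
  have key : thetaMap (c⁻¹ * u * c) (c⁻¹ * g * c) = c⁻¹ * thetaMap u g * c := by
    simp only [thetaMap]
    group
  rwa [h] at key

theorem iterate_thetaMap_conj {c : G} (hc : Commute c u) (g : G) (n : ℕ) :
    (thetaMap u)^[n] (c⁻¹ * g * c) = c⁻¹ * (thetaMap u)^[n] g * c := by
  induction n with
  | zero => rfl
  | succ n ih => rw [Function.iterate_succ_apply', ih, thetaMap_conj hc,
      Function.iterate_succ_apply']

theorem conj_mem_thetaSet {c : G} (hc : Commute c u) {g : G} (hg : g ∈ thetaSet u) :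
    c⁻¹ * g * c ∈ thetaSet u := by
  obtain ⟨n, hn, h⟩ := hg
  exact ⟨n, hn, by rw [iterate_thetaMap_conj hc, h]⟩

/-- Pigeonhole: a forward orbit in a finite group repeats, and its first repeated value is periodic
and still in S. -/
theorem exists_mem_thetaSet [Finite G] {S : Set G} (hS : Set.MapsTo (thetaMap u) S S)
    (hne : S.Nonempty) : ∃ p ∈ S, p ∈ thetaSet u := by
  obtain ⟨x, hx⟩ := hne
  obtain ⟨i, j, hij, h⟩ := Finite.exists_ne_map_eq_of_infinite fun n : ℕ => (thetaMap u)^[n] x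
  wlog hlt : i < j generalizing i j
  · exact this j i hij.symm h.symm (by omega)
  refine ⟨(thetaMap u)^[i] x, hS.iterate i hx, j - i, by omega, ?_⟩
  rw [← Function.iterate_add_apply, Nat.sub_add_cancel hlt.le]
  exact h.symm

/-- If a subgroup `P` of exponent dividing `n` centralizes `u` and acts semiregularly on the
conjugates of a periodic point, then these conjugates lie on at least `|P| / n` orbits. -/
theorem card_le_mul_beta [Finite G] (P : Subgroup G) (hP : ∀ c ∈ P, Commute c u) (n : ℕ)
    (hn : 0 < n) (hexp : ∀ c ∈ P, c ^ n = 1) (p : G) (hp : p ∈ thetaSet u) (hp1 : p ≠ 1)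
    (hfree : ∀ c ∈ P, c⁻¹ * p * c = p → c = 1) : Nat.card P ≤ n * beta u := by
  classical
  have hdet : ∀ c ∈ P, ∀ d ∈ P, c⁻¹ * p * c = d⁻¹ * p * d → c = d := by
    intro c hc d hd h
    have := hfree (c * d⁻¹) (P.mul_mem hc (P.inv_mem hd)) (by
      calc (c * d⁻¹)⁻¹ * p * (c * d⁻¹) = d * (c⁻¹ * p * c) * d⁻¹ := by group
        _ = p := by rw [h]; group)
    exact mul_inv_eq_one.mp this
  obtain ⟨N, hN, hNp⟩ := hp
  -- The least i > 0 for which θ^i p returns to the P-conjugates of p gives an element e that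
  -- accounts for all later returns.
  have hex : ∃ i, 0 < i ∧ ∃ c ∈ P, (thetaMap u)^[i] p = c⁻¹ * p * c :=
    ⟨N, hN, 1, P.one_mem, by simpa using hNp⟩
  obtain ⟨hi, e, he, hie⟩ := Nat.find_spec hex
  set i := Nat.find hex with hidef
  have hmul : ∀ r, (thetaMap u)^[r * i] p = (e ^ r)⁻¹ * p * e ^ r := by
    intro r
    induction r with
    | zero => simp
    | succ r ih =>
      rw [Nat.succ_mul, add_comm, Function.iterate_add_apply, ih,
        iterate_thetaMap_conj (hP _ (P.pow_mem he r)), hie, pow_succ']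
      group
  -- Divide j by i: a nonzero remainder would contradict the minimality of i, and with remainder 0
  -- freeness forces c to be a power of e.
  have hcyc : ∀ j, ∀ c ∈ P, (thetaMap u)^[j] p = c⁻¹ * p * c → ∃ r, c = e ^ r := by
    intro j c hc hj
    have hd := Nat.mod_add_div j i
    rw [← hd, Function.iterate_add_apply, mul_comm i, hmul,
      iterate_thetaMap_conj (hP _ (P.pow_mem he _))] at hj
    by_cases h0 : j % i = 0
    · refine ⟨j / i, ?_⟩
      rw [h0, Function.iterate_zero, id] at hj
      exact (hdet _ (P.pow_mem he _) _ hc hj).symm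
    · refine absurd ⟨Nat.pos_of_ne_zero h0, c * (e ^ (j / i))⁻¹,
        P.mul_mem hc (P.inv_mem (P.pow_mem he _)), ?_⟩ (Nat.find_min hex (Nat.mod_lt j hi))
      calc (thetaMap u)^[j % i] p
          = e ^ (j / i) * ((e ^ (j / i))⁻¹ * (thetaMap u)^[j % i] p * e ^ (j / i)) *
            (e ^ (j / i))⁻¹ := by group
        _ = (c * (e ^ (j / i))⁻¹)⁻¹ * p * (c * (e ^ (j / i))⁻¹) := by rw [hj]; group
  have : Fintype P := Fintype.ofFinite P
  have : Fintype (eventualOrbits u) := Fintype.ofFinite _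
  let f : P → Set G := fun c => thetaOrbit u ((c : G)⁻¹ * p * c)
  have hf : ∀ c ∈ (Finset.univ : Finset P), f c ∈ (eventualOrbits u).toFinset := by
    intro c _
    rw [Set.mem_toFinset]
    refine ⟨⟨_, conj_mem_thetaSet (hP c c.2) ⟨N, hN, hNp⟩, rfl⟩, fun h => hp1 ?_⟩
    have hmem : (c : G)⁻¹ * p * c ∈ f c := ⟨0, rfl⟩
    rw [Set.mem_singleton_iff] at h
    rw [h, Set.mem_singleton_iff] at hmem
    calc p = c * ((c : G)⁻¹ * p * c) * (c : G)⁻¹ := by group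
      _ = 1 := by rw [hmem]; group
  have hfib : ∀ o ∈ (eventualOrbits u).toFinset,
      (Finset.univ.filter fun c => f c = o).card ≤ n := by
    intro o _
    rcases (Finset.univ.filter fun c => f c = o).eq_empty_or_nonempty with h | ⟨c₀, h₀⟩
    · simp [h]
    -- Each fibre lies in a single coset of ⟨e⟩, and eⁿ = 1.
    have hsub : ((Finset.univ.filter fun c => f c = o).image ((↑) : P → G)) ⊆
        (Finset.range n).image fun r => e ^ r * (c₀ : G) := by
      intro x hx
      simp only [Finset.mem_image, Finset.mem_filter, Finset.mem_univ, true_and] at hx h₀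
      obtain ⟨c, hc, rfl⟩ := hx
      have hmem : (c : G)⁻¹ * p * c ∈ f c₀ := by
        rw [h₀, ← hc]
        exact ⟨0, rfl⟩
      obtain ⟨j, hj⟩ := hmem
      simp only [iterate_thetaMap_conj (hP _ c₀.2)] at hj
      obtain ⟨r, hr⟩ := hcyc j (c * (c₀ : G)⁻¹) (P.mul_mem c.2 (P.inv_mem c₀.2)) (by
        calc (thetaMap u)^[j] p
            = c₀ * ((c₀ : G)⁻¹ * (thetaMap u)^[j] p * c₀) * (c₀ : G)⁻¹ := by group
          _ = _ := by rw [hj]; group)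
      rw [Finset.mem_image]
      refine ⟨r % n, Finset.mem_range.mpr (Nat.mod_lt _ hn), ?_⟩
      rw [← pow_eq_pow_mod r (hexp e he), ← hr, inv_mul_cancel_right]
    calc _ = ((Finset.univ.filter fun c => f c = o).image ((↑) : P → G)).card :=
          (Finset.card_image_of_injective _ Subtype.val_injective).symm
      _ ≤ _ := Finset.card_le_card hsub
      _ ≤ _ := Finset.card_image_le.trans (Finset.card_range n).le
  have := Finset.card_le_mul_card_image_of_maps_to hf n hfib
  rwa [Finset.card_univ, ← Nat.card_eq_fintype_card, ← Set.ncard_eq_toFinset_card'] at this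

end Orbits

/-! ### Matrix identities in the Suzuki group. -/

section Matrices

variable {F : Type*} [Field F] {m : ℕ}

theorem two_eq_zero_of_card [Finite F] (hF : Nat.card F = 2 ^ (2 * m + 1)) : (2 : F) = 0 := by
  have : Fintype F := Fintype.ofFinite F
  have h := FiniteField.cast_card_eq_zero F
  rw [← Nat.card_eq_fintype_card, hF] at h
  push_cast at h
  exact pow_eq_zero_iff (by omega) |>.mp h

/-- Here s² = 2q, and x^q = x. -/
theorem pow_two_pow_pow_two_pow [Finite F] (hF : Nat.card F = 2 ^ (2 * m + 1)) (x : F) :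
    (x ^ 2 ^ (m + 1)) ^ 2 ^ (m + 1) = x ^ 2 := by
  have : Fintype F := Fintype.ofFinite F
  have h := FiniteField.pow_card x
  rw [← Nat.card_eq_fintype_card, hF] at h
  rw [← pow_mul, ← pow_add, show m + 1 + (m + 1) = 2 * m + 1 + 1 by ring, pow_succ, pow_mul, h]

theorem add_pow_two_pow (h2 : (2 : F) = 0) (n : ℕ) (x y : F) :
    (x + y) ^ 2 ^ n = x ^ 2 ^ n + y ^ 2 ^ n := by
  have : CharP F 2 := CharTwo.of_one_ne_zero_of_two_eq_zero one_ne_zero h2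
  exact add_pow_char_pow x y 2 n

/-- The matrix underlying `suzukiT`, with the powers `a ^ 2 ^ (m + 1)` and `b ^ 2 ^ (m + 1)` as
independent entries `A` and `B`. -/
def suzukiTMatrix (a A b B : F) : Matrix (Fin 4) (Fin 4) F :=
  !![1, 0, 0, 0; a, 1, 0, 0; a * A + b, A, 1, 0; a ^ 2 * A + a * b + B, b, a, 1]

/-- The diagonal matrix with entries `y`, `x`, `x⁻¹`, `y⁻¹`. -/
def suzukiDMatrix (y x : F) : Matrix (Fin 4) (Fin 4) F :=
  !![y, 0, 0, 0; 0, x, 0, 0; 0, 0, x⁻¹, 0; 0, 0, 0, y⁻¹]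

/-- The matrix underlying `suzukiZ`. -/
def suzukiZMatrix (F : Type*) [Field F] : Matrix (Fin 4) (Fin 4) F :=
  !![0, 0, 0, 1; 0, 0, 1, 0; 0, 1, 0, 0; 1, 0, 0, 0]

theorem coe_suzukiT (a b : F) : (suzukiT m a b : Matrix (Fin 4) (Fin 4) F) =
    suzukiTMatrix a (a ^ 2 ^ (m + 1)) b (b ^ 2 ^ (m + 1)) := by
  simp only [suzukiT, suzukiTMatrix, pow_add a, pow_one]

theorem coe_suzukiD (k : Fˣ) : (suzukiD m k : Matrix (Fin 4) (Fin 4) F) =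
    suzukiDMatrix ((k : F) ^ (2 ^ m + 1)) ((k : F) ^ 2 ^ m) := by
  ext i j
  fin_cases i <;> fin_cases j <;> rfl

theorem coe_suzukiZ : (suzukiZ F : Matrix (Fin 4) (Fin 4) F) = suzukiZMatrix F := rfl

theorem suzukiTMatrix_mul (h2 : (2 : F) = 0) (a A b B c C d D : F) :
    suzukiTMatrix a A b B * suzukiTMatrix c C d D =
      suzukiTMatrix (a + c) (A + C) (b + d + a * C) (B + D + A * c ^ 2) := by
  ext i j
  fin_cases i <;> fin_cases j <;>
    simp [suzukiTMatrix, Matrix.mul_apply, Fin.sum_univ_four] <;> grind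

theorem suzukiT_mul (h2 : (2 : F) = 0) (hσ : ∀ x : F, (x ^ 2 ^ (m + 1)) ^ 2 ^ (m + 1) = x ^ 2)
    (a b c d : F) :
    suzukiT m a b * suzukiT m c d = suzukiT m (a + c) (b + d + a * c ^ 2 ^ (m + 1)) := by
  apply Subtype.ext
  rw [Matrix.SpecialLinearGroup.coe_mul]
  simp only [coe_suzukiT, suzukiTMatrix_mul h2, add_pow_two_pow h2, mul_pow, hσ]

theorem suzukiZ_mul_self : suzukiZ F * suzukiZ F = 1 := by
  apply Subtype.ext
  rw [Matrix.SpecialLinearGroup.coe_mul, Matrix.SpecialLinearGroup.coe_one]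
  ext i j
  fin_cases i <;> fin_cases j <;>
    simp [coe_suzukiZ, suzukiZMatrix, Matrix.mul_apply, Fin.sum_univ_four]

theorem suzukiD_mul (k l : Fˣ) : suzukiD m k * suzukiD m l = suzukiD m (k * l) := by
  apply Subtype.ext
  rw [Matrix.SpecialLinearGroup.coe_mul]
  ext i j
  fin_cases i <;> fin_cases j <;>
    simp [coe_suzukiD, suzukiDMatrix, Matrix.mul_apply, Fin.sum_univ_four, mul_pow, mul_comm]

theorem suzukiD_mul_suzukiZ (k : Fˣ) :
    suzukiD m k * suzukiZ F = suzukiZ F * suzukiD m k⁻¹ := by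
  apply Subtype.ext
  rw [Matrix.SpecialLinearGroup.coe_mul, Matrix.SpecialLinearGroup.coe_mul]
  ext i j
  fin_cases i <;> fin_cases j <;>
    simp [coe_suzukiD, coe_suzukiZ, suzukiDMatrix, suzukiZMatrix, Matrix.mul_apply,
      Fin.sum_univ_four]

theorem suzukiTMatrix_mul_suzukiDMatrix {k x : F} (hk : k ≠ 0) (hx : x ≠ 0) (a A b B : F) :
    suzukiTMatrix a A b B * suzukiDMatrix (x * k) x =
      suzukiDMatrix (x * k) x *
        suzukiTMatrix (k * a) (x ^ 2 * A) (k * x ^ 2 * b) (x ^ 2 * k ^ 2 * B) := by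
  ext i j
  fin_cases i <;> fin_cases j <;>
    simp [suzukiTMatrix, suzukiDMatrix, Matrix.mul_apply, Fin.sum_univ_four] <;> field_simp

theorem suzukiT_mul_suzukiD (hσ : ∀ x : F, (x ^ 2 ^ (m + 1)) ^ 2 ^ (m + 1) = x ^ 2)
    (k : Fˣ) (a b : F) :
    suzukiT m a b * suzukiD m k =
      suzukiD m k * suzukiT m (k * a) (k ^ (1 + 2 ^ (m + 1)) * b) := by
  have hx : (k : F) ^ 2 ^ (m + 1) = (k ^ 2 ^ m) ^ 2 := by ring
  apply Subtype.ext
  rw [Matrix.SpecialLinearGroup.coe_mul, Matrix.SpecialLinearGroup.coe_mul]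
  simp only [coe_suzukiT, coe_suzukiD, pow_succ (k : F) (2 ^ m), mul_pow, pow_add (k : F) 1, hσ,
    pow_one]
  rw [suzukiTMatrix_mul_suzukiDMatrix k.ne_zero (pow_ne_zero _ k.ne_zero), hx]

/-- Used in the form z u z = T(1, 0)⁻¹ z T(1, 0), with u = T(0, 1). -/
theorem suzukiT_conj_suzukiZ (h2 : (2 : F) = 0) :
    suzukiT m 1 0 * suzukiZ F * suzukiT m 0 1 * suzukiZ F = suzukiZ F * suzukiT m (1 : F) 0 := by
  apply Subtype.ext
  simp only [Matrix.SpecialLinearGroup.coe_mul, coe_suzukiT, coe_suzukiZ]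
  ext i j
  fin_cases i <;> fin_cases j <;>
    simp [suzukiTMatrix, suzukiZMatrix, Matrix.mul_apply, Fin.sum_univ_four] <;> grind

/-- N is the lower left entry of T(a, b), and M becomes N^s once A = a^s and B = b^s. With these as
free variables, the Bruhat relation is a rational identity in characteristic 2. -/
theorem suzukiZMatrix_conj_suzukiTMatrix (h2 : (2 : F) = 0) {a A b B N M : F}
    (hN : N = a ^ 2 * A + a * b + B) (hM : M = A ^ 2 * a ^ 2 + A * B + b ^ 2) (hN0 : N ≠ 0)
    (hM0 : M ≠ 0) :
    suzukiZMatrix F * suzukiTMatrix a A b B * suzukiZMatrix F =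
      suzukiTMatrix ((a * A + b) / N) ((A * a ^ 2 + B) / M)
        (a / N + (a * A + b) / N * ((A * a ^ 2 + B) / M))
        (A / M + ((a * A + b) / N) ^ 2 * ((A * a ^ 2 + B) / M)) *
      (suzukiZMatrix F * suzukiDMatrix N⁻¹ (N / M)) *
        suzukiTMatrix (b / N) (B / M) (a / N) (A / M) := by
  ext i j
  fin_cases i <;> fin_cases j <;>
    simp [suzukiTMatrix, suzukiZMatrix, suzukiDMatrix, Matrix.mul_apply, Fin.sum_univ_four] <;>
    field_simp <;> subst hN hM <;> clear hN0 hM0 <;> grind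

theorem pow_card_of_card [Finite F] (hF : Nat.card F = 2 ^ (2 * m + 1)) (x : F) :
    x ^ 2 ^ (2 * m + 1) = x := by
  have : Fintype F := Fintype.ofFinite F
  rw [← hF, Nat.card_eq_fintype_card, FiniteField.pow_card]

theorem suzukiT_zero_zero : suzukiT m (0 : F) 0 = 1 := by
  apply Subtype.ext
  rw [coe_suzukiT, Matrix.SpecialLinearGroup.coe_one]
  ext i j
  fin_cases i <;> fin_cases j <;> simp [suzukiTMatrix]

theorem suzukiT_injective {a b c d : F} (h : suzukiT m a b = suzukiT m c d) : a = c ∧ b = d := by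
  have h' : (suzukiT m a b : Matrix (Fin 4) (Fin 4) F) = suzukiT m c d := by rw [h]
  rw [coe_suzukiT, coe_suzukiT] at h'
  exact ⟨by simpa [suzukiTMatrix] using congrFun (congrFun h' 1) 0,
    by simpa [suzukiTMatrix] using congrFun (congrFun h' 3) 1⟩

theorem suzukiT_inv [Finite F] (hF : Nat.card F = 2 ^ (2 * m + 1)) (a b : F) :
    (suzukiT m a b)⁻¹ = suzukiT m a (b + a * a ^ 2 ^ (m + 1)) := by
  have h2 := two_eq_zero_of_card hF
  rw [inv_eq_iff_mul_eq_one, suzukiT_mul h2 (pow_two_pow_pow_two_pow hF), ← suzukiT_zero_zero]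
  congr 1 <;> grind

theorem suzukiT_zero_mul_self [Finite F] (hF : Nat.card F = 2 ^ (2 * m + 1)) (b : F) :
    suzukiT m 0 b * suzukiT m 0 b = 1 := by
  have h2 := two_eq_zero_of_card hF
  rw [suzukiT_mul h2 (pow_two_pow_pow_two_pow hF), ← suzukiT_zero_zero]
  congr 1 <;> grind

theorem suzukiT_mul_self [Finite F] (hF : Nat.card F = 2 ^ (2 * m + 1)) (a b : F) :
    suzukiT m a b * suzukiT m a b = suzukiT m 0 (a * a ^ 2 ^ (m + 1)) := by
  have h2 := two_eq_zero_of_card hF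
  rw [suzukiT_mul h2 (pow_two_pow_pow_two_pow hF)]
  congr 1 <;> grind

theorem suzukiT_pow_four [Finite F] (hF : Nat.card F = 2 ^ (2 * m + 1)) (a b : F) :
    suzukiT m a b ^ 4 = 1 := by
  rw [pow_mul (suzukiT m a b) 2 2, pow_two (suzukiT m a b), suzukiT_mul_self hF, pow_two,
    suzukiT_zero_mul_self hF]

theorem suzukiT_zero_commute [Finite F] (hF : Nat.card F = 2 ^ (2 * m + 1)) (a b c : F) :
    Commute (suzukiT m a b) (suzukiT m 0 c) := by
  have h2 := two_eq_zero_of_card hF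
  rw [Commute, SemiconjBy, suzukiT_mul h2 (pow_two_pow_pow_two_pow hF),
    suzukiT_mul h2 (pow_two_pow_pow_two_pow hF), zero_pow (by positivity)]
  congr 1 <;> ring

theorem suzukiT_zero_mul [Finite F] (hF : Nat.card F = 2 ^ (2 * m + 1)) (b d : F) :
    suzukiT m 0 b * suzukiT m 0 d = suzukiT m 0 (b + d) := by
  rw [suzukiT_mul (two_eq_zero_of_card hF) (pow_two_pow_pow_two_pow hF), zero_mul, add_zero,
    add_zero]

/-- The torus homomorphism `k ↦ D(k)`. -/
def suzukiDHom (m : ℕ) (F : Type*) [Field F] : Fˣ →* Matrix.SpecialLinearGroup (Fin 4) F :=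
  MonoidHom.mk' (suzukiD m) fun k l => (suzukiD_mul k l).symm

theorem suzukiD_inv (k : Fˣ) : (suzukiD m k)⁻¹ = suzukiD m k⁻¹ :=
  (map_inv (suzukiDHom m F) k).symm

theorem suzukiZ_inv : (suzukiZ F)⁻¹ = suzukiZ F := inv_eq_of_mul_eq_one_left suzukiZ_mul_self

theorem suzukiD_conj_suzukiT [Finite F] (hF : Nat.card F = 2 ^ (2 * m + 1)) (k : Fˣ) (a b : F) :
    (suzukiD m k)⁻¹ * suzukiT m a b * suzukiD m k =
      suzukiT m (k * a) (k ^ (1 + 2 ^ (m + 1)) * b) := by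
  rw [mul_assoc, suzukiT_mul_suzukiD (pow_two_pow_pow_two_pow hF), inv_mul_cancel_left]

/-- Take k = e^(s-1): then k^(s+1) = e^(s²-1) = e²/e = e. -/
theorem exists_pow_one_add_eq [Finite F] (hF : Nat.card F = 2 ^ (2 * m + 1)) {e : F}
    (he : e ≠ 0) : ∃ k : Fˣ, (k : F) ^ (1 + 2 ^ (m + 1)) = e := by
  have hE : e ^ 2 ^ (m + 1) ≠ 0 := pow_ne_zero _ he
  refine ⟨Units.mk0 (e ^ 2 ^ (m + 1) / e) (div_ne_zero hE he), ?_⟩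
  rw [Units.val_mk0, pow_add, pow_one, div_pow, pow_two_pow_pow_two_pow hF]
  field_simp

/-- Take k = y^(2-s): since s²/2 = q, k^(s/2) = y^(s-q) = y^(s-1). -/
theorem exists_torus_param [Finite F] (hF : Nat.card F = 2 ^ (2 * m + 1)) {y : F} (hy : y ≠ 0) :
    ∃ k : Fˣ, (k : F) ^ (2 ^ m + 1) = y ∧ (k : F) ^ 2 ^ m = y ^ 2 ^ (m + 1) / y := by
  have hY : y ^ 2 ^ (m + 1) ≠ 0 := pow_ne_zero _ hy
  have hk : (y ^ 2 / y ^ 2 ^ (m + 1)) ^ 2 ^ m = y ^ 2 ^ (m + 1) / y := by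
    rw [div_pow, ← pow_mul, ← pow_mul, ← pow_add, ← pow_succ',
      show m + 1 + m = 2 * m + 1 by ring, pow_card_of_card hF]
  refine ⟨Units.mk0 (y ^ 2 / y ^ 2 ^ (m + 1)) (div_ne_zero (pow_ne_zero _ hy) hY), ?_, hk⟩
  rw [Units.val_mk0, pow_succ, hk]
  field_simp

theorem suzuki_form_ne_zero [Finite F] (hF : Nat.card F = 2 ^ (2 * m + 1)) {a b : F}
    (h : a ≠ 0 ∨ b ≠ 0) :
    a ^ 2 * a ^ 2 ^ (m + 1) + a * b + b ^ 2 ^ (m + 1) ≠ 0 := by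
  intro h0
  have h2 := two_eq_zero_of_card hF
  have h1 := congrArg (fun x : F => x ^ 2 ^ (m + 1)) h0
  simp only [add_pow_two_pow h2, mul_pow, pow_two_pow_pow_two_pow hF,
    zero_pow (Nat.two_pow_pos (m + 1)).ne', pow_right_comm a 2] at h1
  have hA : a ^ 2 ^ (m + 1) = 0 → a = 0 := fun h => eq_zero_of_pow_eq_zero h
  have hB : b ^ 2 ^ (m + 1) = 0 → b = 0 := fun h => eq_zero_of_pow_eq_zero h
  have hB0 : b = 0 → b ^ 2 ^ (m + 1) = 0 := fun h => by rw [h, zero_pow (Nat.two_pow_pos (m + 1)).ne']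
  generalize a ^ 2 ^ (m + 1) = A at *
  generalize b ^ 2 ^ (m + 1) = B at *
  -- Eliminates B between the equation and its image under x ↦ x^s. If b = 0 then a²A = 0; if b = aA
  -- the equation reduces to B = 0. Either way a = b = 0.
  have key : b * (b + a * A) = 0 := by linear_combination h1 - A * h0 + a * A * b * h2
  clear hF
  rcases mul_eq_zero.mp key with hb | hb <;> grind

/-- The Bruhat relation: `z T(a, b) z` lies in the big cell when `T(a, b) ≠ 1`. -/
theorem exists_suzukiZ_conj_suzukiT [Finite F] (hF : Nat.card F = 2 ^ (2 * m + 1)) {a b : F}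
    (h : a ≠ 0 ∨ b ≠ 0) : ∃ (c d : F) (k : Fˣ) (c' d' : F),
      suzukiZ F * suzukiT m a b * suzukiZ F =
        suzukiT m c d * (suzukiZ F * suzukiD m k) * suzukiT m c' d' := by
  have h2 := two_eq_zero_of_card hF
  have hN := suzuki_form_ne_zero hF h
  obtain ⟨k, hk1, hk2⟩ := exists_torus_param hF (inv_ne_zero hN)
  set N := a ^ 2 * a ^ 2 ^ (m + 1) + a * b + b ^ 2 ^ (m + 1) with hNdef
  have hNs : N ^ 2 ^ (m + 1) = (a ^ 2 ^ (m + 1)) ^ 2 * a ^ 2 +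
      a ^ 2 ^ (m + 1) * b ^ 2 ^ (m + 1) + b ^ 2 := by
    simp only [hNdef, add_pow_two_pow h2, mul_pow, pow_two_pow_pow_two_pow hF,
      pow_right_comm a 2]
  refine ⟨(a * a ^ 2 ^ (m + 1) + b) / N, a / N + (a * a ^ 2 ^ (m + 1) + b) / N *
    ((a ^ 2 ^ (m + 1) * a ^ 2 + b ^ 2 ^ (m + 1)) / N ^ 2 ^ (m + 1)), k, b / N, a / N, ?_⟩
  apply Subtype.ext
  simp only [Matrix.SpecialLinearGroup.coe_mul, coe_suzukiT, coe_suzukiD, coe_suzukiZ]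
  rw [suzukiZMatrix_conj_suzukiTMatrix h2 hNdef hNs hN (pow_ne_zero _ hN), hk1, hk2]
  simp only [div_pow, mul_pow, add_pow_two_pow h2, pow_two_pow_pow_two_pow hF, inv_pow]
  congr 4
  · field_simp
    rw [pow_right_comm a 2]
    linear_combination a * a ^ 2 ^ (m + 1) * b * (a ^ 2 * a ^ 2 ^ (m + 1) + b ^ 2 ^ (m + 1)) * h2
  · rw [div_inv_eq_mul, div_eq_inv_mul]

end Matrices

/-! ### Bruhat decomposition, and bounds for |G| and |Aut G|. -/

section GroupOrder

variable {F : Type*} [Field F] {m : ℕ}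

theorem suzukiD_mul_suzukiT [Finite F] (hF : Nat.card F = 2 ^ (2 * m + 1)) (k : Fˣ) (a b : F) :
    ∃ c d : F, suzukiD m k * suzukiT m a b = suzukiT m c d * suzukiD m k := by
  have h := suzukiD_conj_suzukiT hF k⁻¹ a b
  rw [suzukiD_inv, inv_inv] at h
  exact ⟨_, _, by rw [← h, ← suzukiD_inv, inv_mul_cancel_right]⟩

theorem suzukiT_mul_mem_range [Finite F] (hF : Nat.card F = 2 ^ (2 * m + 1)) (a b c d : F) :
    ∃ c' d' : F, suzukiT m a b * suzukiT m c d = suzukiT m c' d' :=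
  ⟨_, _, suzukiT_mul (two_eq_zero_of_card hF) (pow_two_pow_pow_two_pow hF) a b c d⟩

/-- The union of the Borel subgroup `{T(a, b) D(k)}` and the big cell `{T(a, b) z D(k) T(c, d)}`. -/
def InBruhatCell (m : ℕ) (g : Matrix.SpecialLinearGroup (Fin 4) F) : Prop :=
  (∃ (a b : F) (k : Fˣ), g = suzukiT m a b * suzukiD m k) ∨
    ∃ (a b : F) (k : Fˣ) (c d : F),
      g = suzukiT m a b * (suzukiZ F * suzukiD m k) * suzukiT m c d

theorem InBruhatCell.suzukiT_mul [Finite F] (hF : Nat.card F = 2 ^ (2 * m + 1))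
    {x : Matrix.SpecialLinearGroup (Fin 4) F} (hx : InBruhatCell m x) (e f : F) :
    InBruhatCell m (suzukiT m e f * x) := by
  rcases hx with ⟨a, b, k, rfl⟩ | ⟨a, b, k, c, d, rfl⟩
  · obtain ⟨a', b', h⟩ := suzukiT_mul_mem_range hF e f a b
    exact Or.inl ⟨a', b', k, by rw [← mul_assoc, h]⟩
  · obtain ⟨a', b', h⟩ := suzukiT_mul_mem_range hF e f a b
    exact Or.inr ⟨a', b', k, c, d, by rw [← mul_assoc, ← mul_assoc, h]⟩

theorem InBruhatCell.suzukiD_mul [Finite F] (hF : Nat.card F = 2 ^ (2 * m + 1))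
    {x : Matrix.SpecialLinearGroup (Fin 4) F} (hx : InBruhatCell m x) (l : Fˣ) :
    InBruhatCell m (suzukiD m l * x) := by
  rcases hx with ⟨a, b, k, rfl⟩ | ⟨a, b, k, c, d, rfl⟩
  · obtain ⟨a', b', h⟩ := suzukiD_mul_suzukiT hF l a b
    exact Or.inl ⟨a', b', l * k, by rw [← mul_assoc, h, mul_assoc, _root_.suzukiD_mul]⟩
  · obtain ⟨a', b', h⟩ := suzukiD_mul_suzukiT hF l a b
    refine Or.inr ⟨a', b', l⁻¹ * k, c, d, ?_⟩
    rw [← _root_.suzukiD_mul, ← mul_assoc (suzukiZ F), ← suzukiD_mul_suzukiZ]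
    simp only [← mul_assoc, h]

/-- On the big cell, z T(a, b) z is rewritten by the Bruhat relation; when T(a, b) = 1 the two
factors z cancel and the product falls into the Borel subgroup. -/
theorem InBruhatCell.suzukiZ_mul [Finite F] (hF : Nat.card F = 2 ^ (2 * m + 1))
    {x : Matrix.SpecialLinearGroup (Fin 4) F} (hx : InBruhatCell m x) :
    InBruhatCell m (suzukiZ F * x) := by
  rcases hx with ⟨a, b, k, rfl⟩ | ⟨a, b, k, c, d, rfl⟩
  · exact Or.inr ⟨0, 0, k, k * a, k ^ (1 + 2 ^ (m + 1)) * b, by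
      rw [suzukiT_zero_zero, one_mul, mul_assoc,
        ← suzukiT_mul_suzukiD (pow_two_pow_pow_two_pow hF)]⟩
  · by_cases hab : a ≠ 0 ∨ b ≠ 0
    · obtain ⟨a₁, b₁, l, a₂, b₂, h⟩ := exists_suzukiZ_conj_suzukiT hF hab
      obtain ⟨c', d', h'⟩ := suzukiT_mul_mem_range hF (k * a₂) (k ^ (1 + 2 ^ (m + 1)) * b₂) c d
      refine Or.inr ⟨a₁, b₁, l * k, c', d', ?_⟩
      rw [← h', ← _root_.suzukiD_mul]
      calc _ = (suzukiZ F * suzukiT m a b * suzukiZ F) * suzukiD m k * suzukiT m c d := by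
            simp only [mul_assoc]
        _ = suzukiT m a₁ b₁ * (suzukiZ F * suzukiD m l) * (suzukiT m a₂ b₂ * suzukiD m k) *
            suzukiT m c d := by rw [h]; simp only [mul_assoc]
        _ = _ := by
            rw [suzukiT_mul_suzukiD (pow_two_pow_pow_two_pow hF)]; simp only [mul_assoc]
    · push Not at hab
      obtain ⟨a', b', h'⟩ := suzukiD_mul_suzukiT hF k c d
      refine Or.inl ⟨a', b', k, ?_⟩
      rw [hab.1, hab.2, suzukiT_zero_zero, one_mul, ← mul_assoc, ← mul_assoc, suzukiZ_mul_self,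
        one_mul, h']

/-- The Bruhat decomposition of the Suzuki group (existence part). -/
theorem inBruhatCell_of_mem [Finite F] (hF : Nat.card F = 2 ^ (2 * m + 1))
    {g : Matrix.SpecialLinearGroup (Fin 4) F} (hg : g ∈ suzukiGroup m F) : InBruhatCell m g := by
  have hone : (1 : Matrix.SpecialLinearGroup (Fin 4) F) = suzukiT m 0 0 * suzukiD m 1 := by
    rw [suzukiT_zero_zero, one_mul]
    exact (map_one (suzukiDHom m F)).symm
  induction hg using Subgroup.closure_induction_left with
  | one => exact Or.inl ⟨0, 0, 1, hone⟩
  | mul_left x hx y _ ih =>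
    rcases hx with (⟨a, b, rfl⟩ | ⟨k, rfl⟩) | rfl
    · exact ih.suzukiT_mul hF a b
    · exact ih.suzukiD_mul hF k
    · exact ih.suzukiZ_mul hF
  | inv_mul_cancel x hx y _ ih =>
    rcases hx with (⟨a, b, rfl⟩ | ⟨k, rfl⟩) | rfl
    · rw [suzukiT_inv hF]
      exact ih.suzukiT_mul hF _ _
    · rw [suzukiD_inv]
      exact ih.suzukiD_mul hF _
    · rw [suzukiZ_inv]
      exact ih.suzukiZ_mul hF

/-- The two cells have at most q²(q - 1) + q⁴(q - 1) ≤ q⁵ elements; uniqueness of the decomposition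
is not needed. -/
theorem card_suzukiGroup_le [Finite F] (hF : Nat.card F = 2 ^ (2 * m + 1)) :
    Nat.card (suzukiGroup m F) ≤ (2 ^ (2 * m + 1)) ^ 5 := by
  let f : (F × F × Fˣ) ⊕ (F × F × Fˣ × F × F) → Matrix.SpecialLinearGroup (Fin 4) F :=
    Sum.elim (fun x => suzukiT m x.1 x.2.1 * suzukiD m x.2.2)
      fun x => suzukiT m x.1 x.2.1 * (suzukiZ F * suzukiD m x.2.2.1) *
        suzukiT m x.2.2.2.1 x.2.2.2.2
  have hsub : (suzukiGroup m F : Set (Matrix.SpecialLinearGroup (Fin 4) F)) ⊆ Set.range f := by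
    intro g hg
    rcases inBruhatCell_of_mem hF hg with ⟨a, b, k, rfl⟩ | ⟨a, b, k, c, d, rfl⟩
    · exact ⟨Sum.inl (a, b, k), rfl⟩
    · exact ⟨Sum.inr (a, b, k, c, d), rfl⟩
  have hcard : Nat.card (suzukiGroup m F) ≤ Nat.card ((F × F × Fˣ) ⊕ (F × F × Fˣ × F × F)) :=
    (Nat.card_mono (Set.finite_range f) hsub).trans (Finite.card_range_le f)
  have hunits : Nat.card F = Nat.card Fˣ + 1 := Nat.card_eq_card_units_add_one F
  refine hcard.trans ?_
  rw [← hF]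
  simp only [Nat.card_sum, Nat.card_prod, hunits]
  generalize Nat.card Fˣ = r
  nlinarith [Nat.zero_le (r ^ 4), Nat.zero_le (r ^ 3), Nat.zero_le (r ^ 2), Nat.zero_le r]

/-- A subgroup containing `D(k₀)`, for a generator `k₀` of `Fˣ`, as well as `T(1, 0)` and `z`
contains the Suzuki group. -/
theorem suzukiGroup_le [Finite F] (hF : Nat.card F = 2 ^ (2 * m + 1))
    {K : Subgroup (Matrix.SpecialLinearGroup (Fin 4) F)} {k₀ : Fˣ}
    (hk₀ : ∀ k, k ∈ Subgroup.zpowers k₀) (hD : suzukiD m k₀ ∈ K) (hT : suzukiT m 1 0 ∈ K)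
    (hZ : suzukiZ F ∈ K) : suzukiGroup m F ≤ K := by
  have hDk : ∀ k, suzukiD m k ∈ K := by
    intro k
    obtain ⟨n, rfl⟩ := Subgroup.mem_zpowers_iff.mp (hk₀ k)
    have : suzukiD m (k₀ ^ n) = suzukiD m k₀ ^ n := map_zpow (suzukiDHom m F) k₀ n
    rw [this]
    exact K.zpow_mem hD n
  have hconj : ∀ (k : Fˣ) (a b : F), suzukiT m a b ∈ K →
      suzukiT m (k * a) (k ^ (1 + 2 ^ (m + 1)) * b) ∈ K := by
    intro k a b h
    rw [← suzukiD_conj_suzukiT hF]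
    exact K.mul_mem (K.mul_mem (K.inv_mem (hDk k)) h) (hDk k)
  have h0 : suzukiT m (0 : F) 0 ∈ K := suzukiT_zero_zero (F := F) (m := m) ▸ K.one_mem
  have ha : ∀ a : F, suzukiT m a 0 ∈ K := by
    intro a
    by_cases h : a = 0
    · rwa [h]
    · simpa using hconj (Units.mk0 a h) 1 0 hT
  -- T(1, 0)² = T(0, 1), whose torus conjugates are all T(0, b) with b ≠ 0.
  have h01 : suzukiT m (0 : F) 1 ∈ K := by
    have := K.mul_mem hT hT
    rwa [suzukiT_mul_self hF, one_pow, one_mul] at this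
  have hb : ∀ b : F, suzukiT m 0 b ∈ K := by
    intro b
    by_cases h : b = 0
    · rwa [h]
    · obtain ⟨k, rfl⟩ := exists_pow_one_add_eq hF h
      simpa using hconj k 0 1 h01
  refine (Subgroup.closure_le K).mpr ?_
  rintro x ((⟨a, b, rfl⟩ | ⟨k, rfl⟩) | rfl)
  · have := K.mul_mem (ha a) (hb b)
    rwa [suzukiT_mul (two_eq_zero_of_card hF) (pow_two_pow_pow_two_pow hF), add_zero, zero_add,
      zero_pow (Nat.two_pow_pos _).ne', mul_zero, add_zero] at this
  · exact hDk k
  · exact hZ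

theorem card_mulAut_le_of_closure_eq_top {G : Type*} [Group G] [Finite G] (x y z : G)
    (h : Subgroup.closure {x, y, z} = ⊤) : Nat.card (MulAut G) ≤ Nat.card G ^ 3 := by
  have hinj : Function.Injective fun φ : MulAut G => (φ x, φ y, φ z) := by
    intro φ ψ hφ
    simp only [Prod.mk.injEq] at hφ
    refine MulEquiv.toMonoidHom_injective (MonoidHom.eq_of_eqOn_dense h ?_)
    rintro w (rfl | rfl | rfl)
    exacts [hφ.1, hφ.2.1, hφ.2.2]
  refine (Nat.card_le_card_of_injective _ hinj).trans_eq ?_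
  rw [Nat.card_prod, Nat.card_prod]
  ring

theorem card_mulAut_suzukiGroup_le [Finite F] (hF : Nat.card F = 2 ^ (2 * m + 1)) :
    Nat.card (MulAut (suzukiGroup m F)) ≤ (2 ^ (2 * m + 1)) ^ 15 := by
  obtain ⟨k₀, hk₀⟩ := IsCyclic.exists_generator (α := Fˣ)
  have hD : suzukiD m k₀ ∈ suzukiGroup m F :=
    Subgroup.subset_closure (Or.inl (Or.inr ⟨k₀, rfl⟩))
  have hZ : suzukiZ F ∈ suzukiGroup m F := Subgroup.subset_closure (Or.inr rfl)
  have htop : Subgroup.closure {(⟨_, hD⟩ : suzukiGroup m F), ⟨_, suzukiT_mem m 1 0⟩, ⟨_, hZ⟩} =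
      ⊤ := by
    rw [eq_top_iff]
    have hle := suzukiGroup_le hF (K := (Subgroup.closure
      {(⟨_, hD⟩ : suzukiGroup m F), ⟨_, suzukiT_mem m 1 0⟩, ⟨_, hZ⟩}).map
        (suzukiGroup m F).subtype) hk₀
      ⟨⟨_, hD⟩, Subgroup.subset_closure (by simp), rfl⟩
      ⟨⟨_, suzukiT_mem m 1 0⟩, Subgroup.subset_closure (by simp), rfl⟩
      ⟨⟨_, hZ⟩, Subgroup.subset_closure (by simp), rfl⟩
    rintro ⟨g, hg⟩ -
    obtain ⟨g', hg', hgg⟩ := hle hg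
    rwa [show (⟨g, hg⟩ : suzukiGroup m F) = g' from Subtype.ext hgg.symm]
  calc _ ≤ Nat.card (suzukiGroup m F) ^ 3 := card_mulAut_le_of_closure_eq_top _ _ _ htop
    _ ≤ ((2 ^ (2 * m + 1)) ^ 5) ^ 3 := Nat.pow_le_pow_left (card_suzukiGroup_le hF) 3
    _ = _ := by rw [← pow_mul]

end GroupOrder

/-! ### Action of θ_u on the elements z D(k) T(0, b). -/

section PeriodicPoints

/-- The group-theoretic core of the construction of periodic points: under these relations
`θ_u` maps `w v` to a conjugate of `w₄ (u v)`. -/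
theorem thetaMap_mul_eq {G : Type*} [Group G] {u v w w₂ w₄ c c' : G} (hu : u * u = 1)
    (hv : v * v = 1) (hw : w * w = 1) (huv : Commute u v) (hc : Commute c (u * v))
    (h : w * u * w = c⁻¹ * w₂ * c) (h' : w₂ * (u * v) * w₂ = c'⁻¹ * w₄ * c')
    (hc' : Commute c' (u * v)) :
    thetaMap u (w * v) = ((u * v)⁻¹ * c' * c * v)⁻¹ * (w₄ * (u * v)) * ((u * v)⁻¹ * c' * c * v) := by
  have hu' : u⁻¹ = u := inv_eq_of_mul_eq_one_left hu
  have hv' : v⁻¹ = v := inv_eq_of_mul_eq_one_left hv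
  have hw' : w⁻¹ = w := inv_eq_of_mul_eq_one_left hw
  have hvuv : v * u * v = u := by rw [← huv.eq, mul_assoc, hv, mul_one]
  calc thetaMap u (w * v) = u * w * (v * u * v) * w * (u * v) * (w * u * w) * v := by
        simp only [thetaMap, mul_inv_rev, hu', hv', hw', mul_assoc]
    _ = (v * u * v) * (w * u * w) * (u * v) * (w * u * w) * v := by
        rw [hvuv]; simp only [mul_assoc]
    -- Since c commutes with uv, the inner conjugators cancel and leave w₂ (uv) w₂, to which the
    -- second relation applies.
    _ = v * (u * v * c⁻¹) * w₂ * (c * (u * v)) * c⁻¹ * w₂ * c * v := by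
        rw [h]; simp only [mul_assoc]
    _ = v * c⁻¹ * (u * v) * (w₂ * (u * v) * w₂) * c * v := by
        rw [hc.eq, ← hc.inv_left.eq]; simp only [mul_assoc, mul_inv_cancel_left]
    _ = v * c⁻¹ * (u * v * c'⁻¹) * w₄ * c' * c * v := by
        rw [h']; simp only [mul_assoc]
    _ = _ := by
        rw [← hc'.inv_left.eq]
        generalize u * v = t
        simp only [mul_inv_rev, inv_inv, hv', mul_assoc, mul_inv_cancel_left]

variable {F : Type*} [Field F] {m : ℕ}

theorem suzukiZ_mul_suzukiD_mul_self (k : Fˣ) :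
    suzukiZ F * suzukiD m k * (suzukiZ F * suzukiD m k) = 1 := by
  rw [mul_assoc, ← mul_assoc (suzukiD m k), suzukiD_mul_suzukiZ, mul_assoc (suzukiZ F) _ _,
    ← mul_assoc, suzukiZ_mul_self, ← suzukiD_inv, inv_mul_cancel, mul_one]

/-- T(0, e) is the conjugate of u by some D(l), so with j = k l⁻¹ the left side is z u z conjugated
by D(j). Now z u z is z conjugated by T(1, 0), and z conjugated by D(j) is z D(j²). -/
theorem exists_conj_suzukiT_zero [Finite F] (hF : Nat.card F = 2 ^ (2 * m + 1)) (k : Fˣ) {e : F}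
    (he : e ≠ 0) : ∃ (l : Fˣ) (a : F),
      suzukiZ F * suzukiD m k * suzukiT m 0 e * (suzukiZ F * suzukiD m k) =
        (suzukiT m a 0)⁻¹ * (suzukiZ F * suzukiD m l) * suzukiT m a 0 := by
  obtain ⟨l, rfl⟩ := exists_pow_one_add_eq hF he
  have hzuz : suzukiZ F * suzukiT m 0 1 * suzukiZ F =
      (suzukiT m 1 0)⁻¹ * suzukiZ F * suzukiT m 1 0 := by
    rw [mul_assoc _ (suzukiZ F), ← suzukiT_conj_suzukiZ (two_eq_zero_of_card hF)]
    simp only [mul_assoc, inv_mul_cancel_left]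
  have hT := suzukiD_conj_suzukiT hF l 0 1
  rw [mul_zero, mul_one] at hT
  have hTj := suzukiT_mul_suzukiD (pow_two_pow_pow_two_pow hF) (k * l⁻¹) 1 0
  rw [mul_one, mul_zero] at hTj
  refine ⟨k * l⁻¹ * (k * l⁻¹), ((k * l⁻¹ : Fˣ) : F), ?_⟩
  rw [← hT]
  have h1 : suzukiD m l * (suzukiZ F * suzukiD m k) = suzukiZ F * suzukiD m (k * l⁻¹) := by
    rw [← mul_assoc, suzukiD_mul_suzukiZ, mul_assoc, suzukiD_mul, mul_comm]
  have h2 : suzukiD m k * (suzukiD m l)⁻¹ = suzukiD m (k * l⁻¹) := by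
    rw [suzukiD_inv, suzukiD_mul]
  generalize k * l⁻¹ = j at *
  calc suzukiZ F * suzukiD m k * ((suzukiD m l)⁻¹ * suzukiT m 0 1 * suzukiD m l) *
        (suzukiZ F * suzukiD m k)
      = suzukiZ F * (suzukiD m k * (suzukiD m l)⁻¹) * suzukiT m 0 1 *
        (suzukiD m l * (suzukiZ F * suzukiD m k)) := by simp only [mul_assoc]
    _ = suzukiZ F * suzukiD m j * suzukiT m 0 1 * (suzukiZ F * suzukiD m j) := by rw [h1, h2]
    _ = (suzukiD m j)⁻¹ * (suzukiZ F * suzukiT m 0 1 * suzukiZ F) * suzukiD m j := by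
        nth_rewrite 1 [suzukiD_inv, ← inv_inv j]
        rw [← suzukiD_mul_suzukiZ]; simp only [mul_assoc]
    _ = (suzukiT m 1 0 * suzukiD m j)⁻¹ * suzukiZ F * (suzukiT m 1 0 * suzukiD m j) := by
        rw [hzuz]; simp only [mul_assoc, mul_inv_rev]
    _ = (suzukiT m (j : F) 0)⁻¹ * ((suzukiD m j)⁻¹ * suzukiZ F * suzukiD m j) *
        suzukiT m (j : F) 0 := by
        rw [hTj]; simp only [mul_assoc, mul_inv_rev]
    _ = _ := by
        rw [suzukiD_inv, suzukiD_mul_suzukiZ, inv_inv, mul_assoc (suzukiZ F), suzukiD_mul]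

/-- With v = T(0, b), uv = T(0, b + 1). The conjugation lemma is applied with e = 1 and then with e
= b + 1, which is nonzero because b ≠ 1. -/
theorem exists_thetaMap_eq_conj [Finite F] (hF : Nat.card F = 2 ^ (2 * m + 1)) (k : Fˣ) {b : F}
    (hb : b ≠ 1) : ∃ (l : Fˣ) (c d : F),
      thetaMap (suzukiT m 0 1) (suzukiZ F * suzukiD m k * suzukiT m 0 b) =
        (suzukiT m c d)⁻¹ * (suzukiZ F * suzukiD m l * suzukiT m 0 (b + 1)) * suzukiT m c d := by
  have h2 := two_eq_zero_of_card hF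
  obtain ⟨k₂, a₂, h₂⟩ := exists_conj_suzukiT_zero hF k (one_ne_zero (α := F))
  have hb1 : b + 1 ≠ 0 := fun h => hb (by linear_combination h - h2)
  obtain ⟨k₄, a₄, h₄⟩ := exists_conj_suzukiT_zero hF k₂ hb1
  have huv : suzukiT m 0 1 * suzukiT m 0 b = suzukiT m 0 (b + 1) := by
    rw [suzukiT_zero_mul hF, add_comm]
  rw [← huv] at h₄
  have key := thetaMap_mul_eq (suzukiT_zero_mul_self hF 1) (suzukiT_zero_mul_self hF b)
    (suzukiZ_mul_suzukiD_mul_self k) (suzukiT_zero_commute hF 0 1 b)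
    (huv ▸ suzukiT_zero_commute hF a₂ 0 (b + 1)) h₂ h₄ (huv ▸ suzukiT_zero_commute hF a₄ 0 (b + 1))
  rw [huv, suzukiT_inv hF] at key
  simp only [suzukiT_mul h2 (pow_two_pow_pow_two_pow hF)] at key
  exact ⟨k₄, _, _, key⟩

theorem coe_suzukiZ_mul_suzukiD_mul_suzukiT (k : Fˣ) (b : F) :
    ((suzukiZ F * suzukiD m k * suzukiT m 0 b : Matrix.SpecialLinearGroup (Fin 4) F) :
      Matrix (Fin 4) (Fin 4) F) 0 =
      ((k : F) ^ (2 ^ m + 1))⁻¹ • ![b ^ 2 ^ (m + 1), b, 0, 1] := by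
  simp only [Matrix.SpecialLinearGroup.coe_mul, coe_suzukiT, coe_suzukiD, coe_suzukiZ]
  ext j
  fin_cases j <;>
    simp [suzukiTMatrix, suzukiZMatrix, suzukiDMatrix, Matrix.mul_apply, Fin.sum_univ_four]

/-- T(a, d) is lower unitriangular, so left multiplication by it keeps the first row. Right
multiplication adds multiples of a and d to that row, visible in columns 2 and 1 (counted from 0).
-/
theorem eq_zero_of_commute_suzukiT {k : Fˣ} {a b d : F}
    (h : Commute (suzukiT m a d) (suzukiZ F * suzukiD m k * suzukiT m 0 b)) : a = 0 ∧ d = 0 := by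
  have hk : (k : F) ^ (2 ^ m + 1) ≠ 0 := pow_ne_zero _ k.ne_zero
  have h' : (suzukiT m a d : Matrix (Fin 4) (Fin 4) F) *
      (suzukiZ F * suzukiD m k * suzukiT m 0 b : Matrix.SpecialLinearGroup (Fin 4) F) =
      (suzukiZ F * suzukiD m k * suzukiT m 0 b : Matrix.SpecialLinearGroup (Fin 4) F) *
        suzukiT m a d := by
    rw [← Matrix.SpecialLinearGroup.coe_mul, h.eq, Matrix.SpecialLinearGroup.coe_mul]
  have h02 := congrFun (congrFun h' 0) 2
  have h01 := congrFun (congrFun h' 0) 1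
  simp only [Matrix.mul_apply, coe_suzukiZ_mul_suzukiD_mul_suzukiT, Fin.sum_univ_four] at h01 h02
  simp [coe_suzukiT, suzukiTMatrix, hk] at h01 h02
  exact ⟨h02, h01⟩

end PeriodicPoints

/-! ### The lower bound for β(u), and the conclusion. -/

section Main

variable {F : Type*} [Field F] {m : ℕ}

/-- The Sylow `2`-subgroup of all `T(a, b)`. -/
def suzukiSylow [Finite F] (hF : Nat.card F = 2 ^ (2 * m + 1)) :
    Subgroup (Matrix.SpecialLinearGroup (Fin 4) F) where
  carrier := {g | ∃ a b, g = suzukiT m a b}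
  one_mem' := ⟨0, 0, suzukiT_zero_zero.symm⟩
  mul_mem' := by
    rintro _ _ ⟨a, b, rfl⟩ ⟨c, d, rfl⟩
    exact suzukiT_mul_mem_range hF a b c d
  inv_mem' := by
    rintro _ ⟨a, b, rfl⟩
    exact ⟨_, _, suzukiT_inv hF a b⟩

theorem card_suzukiSylow [Finite F] (hF : Nat.card F = 2 ^ (2 * m + 1)) :
    Nat.card (suzukiSylow hF) = (2 ^ (2 * m + 1)) ^ 2 := by
  let f : F × F → suzukiSylow hF := fun x => ⟨suzukiT m x.1 x.2, x.1, x.2, rfl⟩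
  have hf : Function.Bijective f := by
    refine ⟨fun x y h => ?_, ?_⟩
    · obtain ⟨h1, h2⟩ := suzukiT_injective (congrArg Subtype.val h)
      exact Prod.ext h1 h2
    · rintro ⟨_, a, b, rfl⟩
      exact ⟨(a, b), rfl⟩
  rw [← Nat.card_congr (Equiv.ofBijective f hf), Nat.card_prod, hF, sq]

theorem orderOf_suzukiU [Finite F] (hF : Nat.card F = 2 ^ (2 * m + 1)) :
    orderOf (suzukiU m F) = 2 := by
  refine orderOf_eq_prime (Subtype.ext ?_) fun h => ?_
  · rw [sq]
    exact suzukiT_zero_mul_self hF 1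
  · have h' : suzukiT m (0 : F) 1 = suzukiT m 0 0 :=
      (congrArg Subtype.val h).trans suzukiT_zero_zero.symm
    exact one_ne_zero (suzukiT_injective h').2

theorem exists_suzuki_mem_thetaSet [Finite F] (hm : 1 ≤ m) (hF : Nat.card F = 2 ^ (2 * m + 1)) :
    ∃ p ∈ thetaSet (suzukiU m F), ∃ (k : Fˣ) (b : F),
      (p : Matrix.SpecialLinearGroup (Fin 4) F) = suzukiZ F * suzukiD m k * suzukiT m 0 b := by
  have h2 := two_eq_zero_of_card hF
  have hZD : ∀ (k : Fˣ) (b : F), suzukiZ F * suzukiD m k * suzukiT m 0 b ∈ suzukiGroup m F :=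
    fun k b => mul_mem (mul_mem (Subgroup.subset_closure (Or.inr rfl))
      (Subgroup.subset_closure (Or.inl (Or.inr ⟨k, rfl⟩)))) (suzukiT_mem m 0 b)
  -- This is where m ≥ 1 enters: q ≥ 8 > 2.
  obtain ⟨b₀, hb₀, hb₁⟩ : ∃ b : F, b ≠ 0 ∧ b ≠ 1 := by
    by_contra! hcon
    have hsub : (Set.univ : Set F) ⊆ {0, 1} := fun b _ => by
      by_cases hb : b = 0
      · exact Or.inl hb
      · exact Or.inr (hcon b hb)
    have h1 := Set.ncard_le_ncard hsub
    have h3 : (2 : ℕ) ^ 3 ≤ 2 ^ (2 * m + 1) := Nat.pow_le_pow_right two_pos (by omega)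
    rw [Set.ncard_univ, hF] at h1
    have h4 := Set.ncard_insert_le (0 : F) {1}
    rw [Set.ncard_singleton] at h4
    omega
  -- The step b ↦ b + 1 requires b ≠ 1, and excluding b = 0 as well makes the condition stable,
  -- since b + 1 swaps 0 and 1.
  let S : Set (suzukiGroup m F) := {g | ∃ (k : Fˣ) (a b c : F), b ≠ 0 ∧ b ≠ 1 ∧
    (g : Matrix.SpecialLinearGroup (Fin 4) F) = (suzukiT m a c)⁻¹ *
      (suzukiZ F * suzukiD m k * suzukiT m 0 b) * suzukiT m a c}
  have hS : Set.MapsTo (thetaMap (suzukiU m F)) S S := by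
    rintro g ⟨k, a, b, c, hb0, hb1, hg⟩
    obtain ⟨l, a', c', hl⟩ := exists_thetaMap_eq_conj hF k hb1
    obtain ⟨a'', c'', hT⟩ := suzukiT_mul_mem_range hF a' c' a c
    refine ⟨l, a'', b + 1, c'', fun h => hb1 (by linear_combination h - h2),
      fun h => hb0 (by linear_combination h), ?_⟩
    have hcoe : ((thetaMap (suzukiU m F) g : suzukiGroup m F) :
        Matrix.SpecialLinearGroup (Fin 4) F) = thetaMap (suzukiT m 0 1) g := rfl
    rw [hcoe, hg, thetaMap_conj (suzukiT_zero_commute hF a c 1), hl, ← hT]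
    simp only [mul_inv_rev, mul_assoc]
  obtain ⟨p, ⟨k, a, b, c, -, -, hp⟩, hper⟩ := exists_mem_thetaSet hS
    ⟨⟨_, hZD 1 b₀⟩, 1, 0, b₀, 0, hb₀, hb₁, by rw [suzukiT_zero_zero]; simp⟩
  have hc : Commute (⟨suzukiT m a c, suzukiT_mem m a c⟩ : suzukiGroup m F) (suzukiU m F) :=
    Subtype.ext (suzukiT_zero_commute hF a c 1)
  -- T(a, c) centralizes u, so undoing the conjugation keeps the point periodic.
  refine ⟨_, conj_mem_thetaSet hc.inv_left hper, k, b, ?_⟩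
  simp only [Subgroup.coe_mul, Subgroup.coe_inv, hp, inv_inv]
  group

/-- The involution `u = T(0, 1)` has at least `q ^ 2 / 4` eventual orbits. -/
theorem sq_card_le_four_mul_beta [Finite F] (hm : 1 ≤ m) (hF : Nat.card F = 2 ^ (2 * m + 1)) :
    (2 ^ (2 * m + 1)) ^ 2 ≤ 4 * beta (suzukiU m F) := by
  obtain ⟨p, hp, k, b, hpk⟩ := exists_suzuki_mem_thetaSet hm hF
  have hle : suzukiSylow hF ≤ suzukiGroup m F := by
    rintro _ ⟨a, b, rfl⟩
    exact suzukiT_mem m a b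
  have hfree : ∀ c ∈ (suzukiSylow hF).subgroupOf (suzukiGroup m F), c⁻¹ * p * c = p → c = 1 := by
    rintro ⟨_, hc⟩ ⟨a, d, rfl⟩ h
    have h' : Commute (⟨suzukiT m a d, hc⟩ : suzukiGroup m F) p := by
      rw [mul_assoc, inv_mul_eq_iff_eq_mul] at h
      exact h.symm
    have h'' := congrArg Subtype.val h'.eq
    simp only [Subgroup.coe_mul, hpk] at h''
    obtain ⟨ha, hd⟩ := eq_zero_of_commute_suzukiT h''
    exact Subtype.ext (by simp [ha, hd, suzukiT_zero_zero])
  rw [← card_suzukiSylow hF, ← Nat.card_congr (Subgroup.subgroupOfEquivOfLe hle).toEquiv]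
  refine card_le_mul_beta _ ?_ 4 (by norm_num) ?_ p hp ?_ hfree
  · rintro ⟨_, hc⟩ ⟨a, d, rfl⟩
    exact Subtype.ext (suzukiT_zero_commute hF a d 1)
  · rintro ⟨_, hc⟩ ⟨a, d, rfl⟩
    exact Subtype.ext (suzukiT_pow_four hF a d)
  -- If p were 1, then u would commute with it, against freeness.
  · intro h1
    have h := hfree ⟨suzukiT m 0 1, suzukiT_mem m 0 1⟩ ⟨0, 1, rfl⟩ (by rw [h1]; group)
    have h' : suzukiT m (0 : F) 1 = suzukiT m 0 0 :=
      (congrArg Subtype.val h).trans suzukiT_zero_zero.symm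
    exact one_ne_zero (suzukiT_injective h').2

end Main

theorem lemma10 (m : ℕ) (hm : 1 ≤ m) {F : Type*} [Field F]
    (hF : Nat.card F = 2 ^ (2 * m + 1)) :
    (∀ κ : ℝ, (∀ u : suzukiGroup m F, orderOf u = 2 → (beta u : ℝ) ≤ κ) →
      (Nat.card (MulAut (suzukiGroup m F)) : ℝ) ≤ κ ^ 12) ∧
    orderOf (suzukiU m F) = 2 ∧
    ((2 : ℝ) ^ (2 * m + 1) - 2) / 2 ≤ (beta (suzukiU m F) : ℝ) := by
  have : Finite F := Nat.finite_of_card_ne_zero (by rw [hF]; positivity)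
  have hβ : ((2 : ℝ) ^ (2 * m + 1)) ^ 2 ≤ 4 * beta (suzukiU m F) := by
    exact_mod_cast sq_card_le_four_mul_beta hm hF
  have hA : (Nat.card (MulAut (suzukiGroup m F)) : ℝ) ≤ ((2 : ℝ) ^ (2 * m + 1)) ^ 15 := by
    exact_mod_cast card_mulAut_suzukiGroup_le hF
  have hq : (8 : ℝ) ≤ 2 ^ (2 * m + 1) := by
    calc (8 : ℝ) = 2 ^ 3 := by norm_num
      _ ≤ _ := pow_le_pow_right₀ one_le_two (by omega)
  refine ⟨fun κ hκ => ?_, orderOf_suzukiU hF, ?_⟩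
  · have hκ' := hκ _ (orderOf_suzukiU hF)
    generalize (2 : ℝ) ^ (2 * m + 1) = q at *
    calc _ ≤ q ^ 15 := hA
      _ = q ^ 15 * 8 ^ 9 / 2 ^ 27 := by ring
      -- There is room to spare: 8⁹ = 2²⁷, while 4¹² = 2²⁴ is enough.
      _ ≤ q ^ 15 * q ^ 9 / 2 ^ 24 := by
          have : (8 : ℝ) ^ 9 ≤ q ^ 9 := pow_le_pow_left₀ (by norm_num) hq 9
          have h15 : 0 ≤ q ^ 15 := by positivity
          nlinarith [mul_le_mul_of_nonneg_left this h15]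
      _ = (q ^ 2 / 4) ^ 12 := by ring
      _ ≤ κ ^ 12 := pow_le_pow_left₀ (by positivity) (by linarith) 12
  · nlinarith
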